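/- A \emph{garden-hose game} of size $s$ for $n$-bit inputs is given as follows. Let $A_\circ=\{0,1^A,\dots,s^A\}$ and $B=\{1^B,\dots,s^B\}$ be disjoint vertex sets ($0$ is the water tap on Alice's side), and let $E=\{\{i^A,i^B\} : 1\le i\le s\}$ be the set of pipes. For every $x\in\{0,1\}^n$ there is a set $E_{A_\circ}(x)$ of edges (without self-loops) on $A_\circ$, and for every $y\in\{0,1\}^n$ a set $E_B(y)$ of edges (without self-loops) on $B$, such that the graphs $(A_\circ,E_{A_\circ}(x))$ and $(B,E_B(y))$ have maximum degree at most $1$. The game \emph{computes} $f:\{0,1\}^n\times\{0,1\}^n\to\{0,1\}$ if, for all $x,y$, the endpoint of the (unique) maximal path starting at $0$ in the graph $(A_\circ\cup B,\;E\cup E_{A_\circ}(x)\cup E_B(y))$ lies in $A_\circ$ when $f(x,y)=0$ and in $B$ when $f(x,y)=1$. The \emph{garden-hose complexity} $\mathrm{gh}(f)$ is the smallest size of a garden-hose game that computes $f$. A family $f=(f_n)_{n\in\mathbb N}$ of functions $f_n:\{0,1\}^n\times\{0,1\}^n\to\{0,1\}$ is \emph{log-space computable} if there are a deterministic Turing machine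 $M$ with a read-only input tape (with end markers) and finitely many work tapes, and a constant $c$, such that for all $n\ge 1$ and all $x,y\in\{0,1\}^n$, the machine $M$, started with the $2n$-bit word $xy$ on its input tape, halts with output $f_n(x,y)$, and its heads visit at most $c\cdot\log_2(2n)$ locations of the work tapes during this computation. \textbf{Theorem.} If $f=(f_n)_{n\in\mathbb N}$ is log-space computable, then $\mathrm{gh}(f_n)$ is polynomial in $n$: there is a polynomial $p$ with coefficients in $\mathbb N$ such that $\mathrm{gh}(f_n)\le p(n)$ for every $n$. -/

import Mathlib

/-! ### The garden-hose game -/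

/-- A garden-hose game for `n`-bit inputs with `size` pipes. Alice's ends of the pipes, together
with the water tap, are the vertices `Option (Fin size)` (`none` is the tap, `some i` is Alice's end
of pipe `i`); Bob's ends are the vertices `Fin size`. Each player chooses, depending only on their
own input, a graph of maximum degree at most one on their own vertices. -/
structure GardenHoseGame (n : ℕ) where
  size : ℕ
  alice : (Fin n → Bool) → SimpleGraph (Option (Fin size))
  bob : (Fin n → Bool) → SimpleGraph (Fin size)
  alice_degree_le_one : ∀ x u v w, (alice x).Adj u v → (alice x).Adj u w → v = w
  bob_degree_le_one : ∀ y u v w, (bob y).Adj u v → (bob y).Adj u w → v = w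

namespace GardenHoseGame

variable {n : ℕ}

/-- The vertices of the game: Alice's side (with the tap) and Bob's side. -/
abbrev Vertex (G : GardenHoseGame n) : Type := Option (Fin G.size) ⊕ Fin G.size

/-- The water tap, on Alice's side. -/
def tap (G : GardenHoseGame n) : G.Vertex := Sum.inl none

/-- Adjacency in `G(x, y)`: the connections of Alice, the connections of Bob, and the pipes. -/
def Adjacent (G : GardenHoseGame n) (x y : Fin n → Bool) : G.Vertex → G.Vertex → Prop
  | Sum.inl u, Sum.inl v => (G.alice x).Adj u v
  | Sum.inr i, Sum.inr j => (G.bob y).Adj i j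
  | Sum.inl u, Sum.inr j => u = some j
  | Sum.inr i, Sum.inl v => v = some i

/-- The graph `G(x, y)`. -/
def graph (G : GardenHoseGame n) (x y : Fin n → Bool) : SimpleGraph G.Vertex where
  Adj := G.Adjacent x y
  symm := ⟨by
    rintro (u | i) (v | j) h
    · exact SimpleGraph.Adj.symm (G := G.alice x) h
    · exact h
    · exact h
    · exact SimpleGraph.Adj.symm (G := G.bob y) h⟩
  loopless := ⟨by
    rintro (u | i) h
    · exact (G.alice x).loopless.irrefl u h
    · exact (G.bob y).loopless.irrefl i h⟩

/-- A path is maximal (among the paths with the same starting point) if it cannot be prolonged at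
its end, i.e. if every neighbour of its endpoint already lies on it. -/
def IsMaximalPath {V : Type} {H : SimpleGraph V} {u v : V} (p : H.Walk u v) : Prop :=
  p.IsPath ∧ ∀ w, H.Adj v w → w ∈ p.support

/-- `v` is the endpoint of the maximal path in `G(x, y)` that starts at the tap: the place where
the water comes out. -/
def WaterExitsAt (G : GardenHoseGame n) (x y : Fin n → Bool) (v : G.Vertex) : Prop :=
  ∃ p : (G.graph x y).Walk G.tap v, IsMaximalPath p

/-- In a graph of maximum degree at most two, a path that arrives from `a` and cannot be prolonged
outside the set `S` of the vertices passed before has only one possible endpoint. -/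
theorem endpoint_unique_aux {V : Type} {H : SimpleGraph V}
    (hH : ∀ u a b c, H.Adj u a → H.Adj u b → H.Adj u c → b ≠ a → c ≠ a → b = c)
    {u v : V} (p : H.Walk u v) : ∀ {w : V} (q : H.Walk u w) (S : Set V) (a : V), a ∈ S →
    H.Adj u a → p.IsPath → q.IsPath → (∀ z ∈ S, z ∉ p.support) → (∀ z ∈ S, z ∉ q.support) →
    (∀ z, H.Adj v z → z ∈ S ∨ z ∈ p.support) → (∀ z, H.Adj w z → z ∈ S ∨ z ∈ q.support) →
    v = w := by
  induction p with
  | nil =>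
    intro w q S a haS ha hp hq hap haq hmp hmq
    cases q with
    | nil => rfl
    | cons h q =>
      rcases hmp _ h with hz | hz
      · exact absurd (by simp) (haq _ hz)
      · simp only [SimpleGraph.Walk.support_nil, List.mem_singleton] at hz
        exact absurd hz h.ne'
  | @cons u u' v h p ih =>
    intro w q S a haS ha hp hq hap haq hmp hmq
    cases q with
    | nil =>
      rcases hmq _ h with hz | hz
      · exact absurd (by simp) (hap _ hz)
      · simp only [SimpleGraph.Walk.support_nil, List.mem_singleton] at hz
        exact absurd hz h.ne'
    | cons h' q =>
      simp only [SimpleGraph.Walk.support_cons, List.mem_cons, not_or] at hap haq hmp hmq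
      obtain rfl := hH _ _ _ _ ha h h' (by rintro rfl; simpa using hap _ haS)
        (by rintro rfl; simpa using haq _ haS)
      rw [SimpleGraph.Walk.cons_isPath_iff] at hp hq
      refine ih q (insert u S) u (Set.mem_insert _ _) h.symm hp.1 hq.1 ?_ ?_ ?_ ?_
      · rintro z (rfl | hz)
        · exact hp.2
        · exact (hap z hz).2
      · rintro z (rfl | hz)
        · exact hq.2
        · exact (haq z hz).2
      · intro z hz
        rcases hmp z hz with h | h | h <;> simp [h]
      · intro z hz
        rcases hmq z hz with h | h | h <;> simp [h]

/-- The endpoint of the maximal path from the tap is unique. -/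
theorem WaterExitsAt.unique {G : GardenHoseGame n} {x y : Fin n → Bool} {v w : G.Vertex}
    (hv : G.WaterExitsAt x y v) (hw : G.WaterExitsAt x y w) : v = w := by
  obtain ⟨p, hp, hmp⟩ := hv
  obtain ⟨q, hq, hmq⟩ := hw
  have htap : ∀ b c, (G.graph x y).Adj G.tap b → (G.graph x y).Adj G.tap c → b = c := by
    rintro (b | b) (c | c) hb hc
    · exact congrArg Sum.inl (G.alice_degree_le_one x _ _ _ hb hc)
    · exact absurd (show (none : Option (Fin G.size)) = some c from hc) (by simp)
    · exact absurd (show (none : Option (Fin G.size)) = some b from hb) (by simp)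
    · exact absurd (show (none : Option (Fin G.size)) = some b from hb) (by simp)
  have hH : ∀ u a b c, (G.graph x y).Adj u a → (G.graph x y).Adj u b → (G.graph x y).Adj u c →
      b ≠ a → c ≠ a → b = c := by
    have hA := G.alice_degree_le_one x
    have hB := G.bob_degree_le_one y
    rintro (u | u) (a | a) (b | b) (c | c) ha hb hc hab hac <;>
      simp only [graph, Adjacent] at ha hb hc <;> grind
  revert p q
  generalize G.tap = t at htap
  intro p hp hmp q hq hmq
  cases p with
  | nil =>
    cases q with
    | nil => rfl
    | cons h q =>
      have := hmp _ h
      simp only [SimpleGraph.Walk.support_nil, List.mem_singleton] at this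
      exact absurd this h.ne'
  | cons h p =>
    cases q with
    | nil =>
      have := hmq _ h
      simp only [SimpleGraph.Walk.support_nil, List.mem_singleton] at this
      exact absurd this h.ne'
    | cons h' q =>
      obtain rfl := htap _ _ h h'
      rw [SimpleGraph.Walk.cons_isPath_iff] at hp hq
      simp only [SimpleGraph.Walk.support_cons, List.mem_cons] at hmp hmq
      exact endpoint_unique_aux hH p q {t} t rfl h.symm hp.1 hq.1
        (by rintro z rfl; exact hp.2) (by rintro z rfl; exact hq.2) hmp hmq

/-- The game computes `f` if the water comes out on Alice's side when `f x y = 0` and on Bob's side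
when `f x y = 1`. -/
def Computes (G : GardenHoseGame n) (f : (Fin n → Bool) → (Fin n → Bool) → Bool) : Prop :=
  ∀ x y, ∃ v, G.WaterExitsAt x y v ∧
    (f x y = false → v.isLeft = true) ∧ (f x y = true → v.isRight = true)

end GardenHoseGame

/-- The garden-hose complexity of `f`: the least number of pipes of a garden-hose game that
computes `f` (it would be `⊤` if there were no such game). -/
noncomputable def gardenHoseComplexity {n : ℕ} (f : (Fin n → Bool) → (Fin n → Bool) → Bool) : ℕ∞ :=
  ⨅ (G : GardenHoseGame n) (_ : G.Computes f), (G.size : ℕ∞)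

/-! ### Deterministic Turing machines with a read-only input tape and work tapes -/

/-- The contents of a cell of the input tape, whose ends are marked. -/
inductive InputSymbol where
  | leftEnd
  | bit (b : Bool)
  | rightEnd

/-- Head movements. -/
inductive HeadMove where
  | left
  | stay
  | right

/-- A deterministic Turing machine with a two-way read-only input tape and `tapes` many two-way
infinite work tapes, with finite state set `State` and finite work alphabet `Symbol`. In one step the
machine reads the scanned input cell and the scanned cell of each work tape, changes its state, moves
the input head, writes on each work tape and moves each work head. -/
structure OfflineTM where
  State : Type
  stateFintype : Fintype State
  Symbol : Type
  symbolFintype : Fintype Symbol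
  blank : Symbol
  tapes : ℕ
  start : State
  accept : State
  reject : State
  accept_ne_reject : accept ≠ reject
  trans : State → InputSymbol → (Fin tapes → Symbol) →
    State × HeadMove × (Fin tapes → Symbol × HeadMove)

namespace OfflineTM

/-- The content of cell `p` of the input tape: cell `0` is the left end marker, cells
`1, …, w.length` hold the input word `w`, and cell `w.length + 1` is the right end marker. -/
def inputSymbol (w : List Bool) : ℕ → InputSymbol
  | 0 => InputSymbol.leftEnd
  | p + 1 =>
    match w[p]? with
    | some b => InputSymbol.bit b
    | none => InputSymbol.rightEnd

/-- Movement of the input head, which never leaves the cells `0, …, N + 1`. -/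
def moveInput (N : ℕ) (p : ℕ) : HeadMove → ℕ
  | HeadMove.left => p - 1
  | HeadMove.stay => p
  | HeadMove.right => min (p + 1) (N + 1)

/-- Movement of a work head. -/
def moveWork (z : ℤ) : HeadMove → ℤ
  | HeadMove.left => z - 1
  | HeadMove.stay => z
  | HeadMove.right => z + 1

/-- A configuration: state, position of the input head, positions of the work heads, contents of
the work tapes. -/
structure Cfg (M : OfflineTM) where
  state : M.State
  inputHead : ℕ
  workHead : Fin M.tapes → ℤ
  work : Fin M.tapes → ℤ → M.Symbol

/-- The starting configuration: blank work tapes, input head on the left end marker. -/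
def init (M : OfflineTM) : M.Cfg where
  state := M.start
  inputHead := 0
  workHead := fun _ => 0
  work := fun _ _ => M.blank

open Classical in
/-- One step of the machine on input `w`. The machine halts when it reaches the accepting or the
rejecting state; a halted configuration is its own successor. -/
noncomputable def step (M : OfflineTM) (w : List Bool) (c : M.Cfg) : M.Cfg :=
  if c.state = M.accept ∨ c.state = M.reject then c
  else
    let r := M.trans c.state (inputSymbol w c.inputHead) (fun i => c.work i (c.workHead i))
    { state := r.1
      inputHead := moveInput w.length c.inputHead r.2.1
      workHead := fun i => moveWork (c.workHead i) (r.2.2 i).2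
      work := fun i => Function.update (c.work i) (c.workHead i) (r.2.2 i).1 }

/-- The configuration after `t` steps on input `w`. -/
noncomputable def run (M : OfflineTM) (w : List Bool) (t : ℕ) : M.Cfg :=
  (M.step w)^[t] M.init

/-- On input `w` the machine halts with output `b`: it accepts for `1` and rejects for `0`. -/
def Outputs (M : OfflineTM) (w : List Bool) (b : Bool) : Prop :=
  ∃ t, (M.run w t).state = if b = true then M.accept else M.reject

/-- The locations of the work tapes visited by the work heads in the computation on input `w`. -/
def visited (M : OfflineTM) (w : List Bool) : Set (Fin M.tapes × ℤ) :=
  {l | ∃ t, (M.run w t).workHead l.1 = l.2}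

end OfflineTM

/-- The family `f`, with one Boolean function of two `n`-bit strings for each `n`, is log-space
computable: a single Turing machine, given the `2 n`-bit word `x y` on its input tape, outputs
`f n x y` and visits at most `c * log (2 n)` locations of its work tapes. Nothing is required for
the empty input word (`n = 0`), where the logarithm makes no sense. -/
def LogSpaceComputable (f : ∀ n : ℕ, (Fin n → Bool) → (Fin n → Bool) → Bool) : Prop :=
  ∃ (M : OfflineTM) (c : ℝ), ∀ n : ℕ, 1 ≤ n → ∀ x y : Fin n → Bool,
    M.Outputs (List.ofFn x ++ List.ofFn y) (f n x y) ∧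
    (M.visited (List.ofFn x ++ List.ofFn y)).Finite ∧
    ((M.visited (List.ofFn x ++ List.ofFn y)).ncard : ℝ) ≤ c * Real.logb 2 (2 * (n : ℝ))

/-! A machine using logarithmic space has only polynomially many configurations. With the input
split as `x y`, the position of the input head decides who can make the next step: Alice if the
scanned cell is in her half, Bob otherwise. Pipes indexed by configurations could thus carry the
water along the computation, except that distinct configurations may have the same successor, while
hoses join pipe ends only in pairs.

The remedy is to make the walk reversible. The configurations that lead to a given halting one form
a tree directed towards it, and instead of the directed path the water follows the tour around this
tree. A tour step exchanges the two ends of an edge and then turns to the next slot of the vertex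
reached, so it is a permutation of the slots. By `swapAlong_swapAlong` the exchange is Alice's
involution followed by Bob's, and each gives a matching of pipe ends.

The tour from the start reaches the last slot of the root (`exists_iterate_tourStep`). There the
player on whose side the water must come out omits the connection (`Computes.game`). With `N`
vertices this takes `2 N (N + 1)` pipes, and `card_boundedCfg_le` bounds `N`. -/

/-! ### Touring the functional graph of a partial map

The corners of a vertex `v` are numbered by `Fin (N + 1)`. The slot `u.castSucc` following the
corner `(v, u.castSucc)` is where an edge from `u` arrives, and the last slot is where the edge
leaving `v` departs. -/

namespace ForestTour

variable {N : ℕ}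

/-- A vertex together with one of its slots. -/
abbrev Corner (N : ℕ) : Type := Fin N × Fin (N + 1)

open Classical in
/-- Exchange the two ends of each edge `v ⟶ w`, `g v = some w`, and fix the slots without edge. -/
noncomputable def swapAlong (g : Fin N → Option (Fin N)) (p : Corner N) : Corner N :=
  Fin.lastCases (motive := fun _ => Corner N)
    ((g p.1).elim (p.1, Fin.last N) fun w => (w, p.1.castSucc))
    (fun u => if g u = some p.1 then (u, Fin.last N) else (p.1, u.castSucc)) p.2

theorem swapAlong_last_of_some {g : Fin N → Option (Fin N)} {v w : Fin N} (h : g v = some w) :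
    swapAlong g (v, Fin.last N) = (w, v.castSucc) := by
  simp [swapAlong, h]

theorem swapAlong_last_of_none {g : Fin N → Option (Fin N)} {v : Fin N} (h : g v = none) :
    swapAlong g (v, Fin.last N) = (v, Fin.last N) := by
  simp [swapAlong, h]

theorem swapAlong_castSucc_of_eq {g : Fin N → Option (Fin N)} {u v : Fin N} (h : g u = some v) :
    swapAlong g (v, u.castSucc) = (u, Fin.last N) := by
  simp [swapAlong, h]

theorem swapAlong_castSucc_of_ne {g : Fin N → Option (Fin N)} {u v : Fin N} (h : g u ≠ some v) :
    swapAlong g (v, u.castSucc) = (v, u.castSucc) := by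
  simp [swapAlong, h]

theorem swapAlong_involutive (g : Fin N → Option (Fin N)) :
    Function.Involutive (swapAlong g) := by
  rintro ⟨v, s⟩
  induction s using Fin.lastCases with
  | last =>
    rcases h : g v with _ | w
    · rw [swapAlong_last_of_none h, swapAlong_last_of_none h]
    · rw [swapAlong_last_of_some h, swapAlong_castSucc_of_eq h]
  | cast u =>
    by_cases h : g u = some v
    · rw [swapAlong_castSucc_of_eq h, swapAlong_last_of_some h]
    · rw [swapAlong_castSucc_of_ne h, swapAlong_castSucc_of_ne h]

/-- Swapping along two partial maps with disjoint domains one after the other is swapping along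
their union. -/
theorem swapAlong_swapAlong {g h : Fin N → Option (Fin N)} (hgh : ∀ v, g v = none ∨ h v = none)
    (p : Corner N) : swapAlong h (swapAlong g p) = swapAlong (fun v => (g v).or (h v)) p := by
  obtain ⟨v, s⟩ := p
  induction s using Fin.lastCases with
  | last =>
    rcases hg : g v with _ | w
    · rw [swapAlong_last_of_none hg]
      rcases hh : h v with _ | w
      · rw [swapAlong_last_of_none hh, swapAlong_last_of_none (by simp [hg, hh])]
      · rw [swapAlong_last_of_some hh, swapAlong_last_of_some (w := w) (by simp [hg, hh])]
    -- The first swap ends at the other end of an edge of `g`. That slot belongs to the same source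
    -- `v`, where `h` is undefined, so the second swap fixes it.
    · have hh : h v = none := (hgh v).resolve_left (by simp [hg])
      rw [swapAlong_last_of_some hg, swapAlong_castSucc_of_ne (by simp [hh]),
        swapAlong_last_of_some (w := w) (by simp [hg])]
  | cast u =>
    by_cases hg : g u = some v
    · have hh : h u = none := (hgh u).resolve_left (by simp [hg])
      rw [swapAlong_castSucc_of_eq hg, swapAlong_last_of_none hh,
        swapAlong_castSucc_of_eq (by simp [hg])]
    · rw [swapAlong_castSucc_of_ne hg]
      by_cases hh : h u = some v
      · have hg' : g u = none := (hgh u).resolve_right (by simp [hh])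
        rw [swapAlong_castSucc_of_eq hh, swapAlong_castSucc_of_eq (by simp [hg', hh])]
      · rw [swapAlong_castSucc_of_ne hh, swapAlong_castSucc_of_ne]
        rcases hgh u with h0 | h0 <;> simp [h0, hg, hh]

/-! ### The tour around a tree -/

/-- Pass to the next slot around the same vertex. -/
def rotate (p : Corner N) : Corner N := (p.1, p.2 + 1)

theorem rotate_injective : Function.Injective (rotate (N := N)) := by
  rintro ⟨v, s⟩ ⟨w, t⟩ h
  simpa [rotate] using h

/-- One step of the tour: follow the edge at the current slot, if any, and turn. -/
noncomputable def tourStep (g : Fin N → Option (Fin N)) (p : Corner N) : Corner N :=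
  rotate (swapAlong g p)

/-- A vertex from which no edge leaves is accessible: its ancestors form a tree. -/
theorem acc_of_eq_none {V : Type} [Finite V] (g : V → Option V) {r : V} (hr : g r = none) :
    Acc (fun u v => g u = some v) r := by
  by_contra hacc
  obtain ⟨c, hc0, hc⟩ := not_acc_iff_exists_descending_chain.1 hacc
  obtain ⟨i, j, hij, hcij⟩ : ∃ i j, i < j ∧ c i = c j := by
    obtain ⟨i, j, hne, h⟩ := Finite.exists_ne_map_eq_of_infinite c
    rcases lt_or_gt_of_ne hne with h' | h'
    · exact ⟨i, j, h', h⟩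
    · exact ⟨j, i, h', h.symm⟩
  -- The chain runs backwards along edges, so applying `g` to both sides pushes a repetition down to
  -- index `0`. Then `r` would have an outgoing edge.
  have key : ∀ i d, c i = c (i + (d + 1)) → c 0 = c (d + 1) := by
    intro i d
    induction i with
    | zero => simp
    | succ i ih =>
      intro h
      apply ih
      have h1 := hc i
      have h2 := hc (i + (d + 1))
      rw [show i + (d + 1) + 1 = i + 1 + (d + 1) by omega, ← h, h1] at h2
      exact Option.some.inj h2
  obtain ⟨d, rfl⟩ : ∃ d, j = i + (d + 1) := ⟨j - i - 1, by omega⟩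
  have h := hc d
  rw [← key i d hcij, hc0, hr] at h
  simp at h

/-- The tour steps from slots other than those at which an edgeless vertex would be left. -/
def Passes (g : Fin N → Option (Fin N)) (p q : Corner N) : Prop :=
  ¬ (p.2 = Fin.last N ∧ g p.1 = none) ∧ q = tourStep g p

/-- From each slot of an accessible vertex the tour leads to the last slot. -/
theorem reflTransGen_passes_last (g : Fin N → Option (Fin N)) {v : Fin N}
    (hv : Acc (fun u v => g u = some v) v) (s : Fin (N + 1)) :
    Relation.ReflTransGen (Passes g) (v, s) (v, Fin.last N) := by
  induction hv generalizing s with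
  | intro v _ ih =>
    -- Either there is no edge at the slot and the tour turns, or it enters the child `u` at slot
    -- `0`, goes around its subtree, and returns at the slot following the one where it left.
    induction s using Fin.reverseInduction with
    | last => exact .refl
    | cast u ihs =>
      have hcut : ¬ ((v, u.castSucc).2 = Fin.last N ∧ g (v, u.castSucc).1 = none) :=
        fun h => (Fin.castSucc_lt_last u).ne h.1
      by_cases hu : g u = some v
      · have h1 : Passes g (v, u.castSucc) (u, 0) :=
          ⟨hcut, by simp [tourStep, swapAlong_castSucc_of_eq hu, rotate]⟩
        have h2 : Passes g (u, Fin.last N) (v, u.succ) :=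
          ⟨by simp [hu], by simp [tourStep, swapAlong_last_of_some hu, rotate]⟩
        exact ((Relation.ReflTransGen.single h1).trans ((ih u hu 0).tail h2)).trans ihs
      · have h1 : Passes g (v, u.castSucc) (v, u.succ) :=
          ⟨hcut, by simp [tourStep, swapAlong_castSucc_of_ne hu, rotate]⟩
        exact (Relation.ReflTransGen.single h1).trans ihs

/-- The tour leads from a vertex to the end of the maximal directed path starting there. -/
theorem reflTransGen_passes_of_reflTransGen (g : Fin N → Option (Fin N)) {v r : Fin N}
    (hr : g r = none) (hvr : Relation.ReflTransGen (fun u v => g u = some v) v r) :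
    Relation.ReflTransGen (Passes g) (v, Fin.last N) (r, Fin.last N) := by
  have hacc : ∀ w, Relation.ReflTransGen (fun u v => g u = some v) w r →
      Acc (fun u v => g u = some v) w := by
    intro w hw
    induction hw using Relation.ReflTransGen.head_induction_on with
    | refl => exact acc_of_eq_none g hr
    | head h _ ih => exact ih.inv h
  induction hvr using Relation.ReflTransGen.head_induction_on with
  | refl => exact .refl
  | @head v w h hw ih =>
    -- Arriving at `w` from `v`, the tour still has to go around the children of `w` in the later
    -- slots before it can leave `w`.
    have h1 : Passes g (v, Fin.last N) (w, v.succ) :=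
      ⟨by simp [h], by simp [tourStep, swapAlong_last_of_some h, rotate]⟩
    exact ((Relation.ReflTransGen.single h1).trans
      (reflTransGen_passes_last g (hacc w hw) _)).trans ih

/-- Counting the steps records that the exit is met at time `K` and not before. This is what later
prevents the water from stopping early or running in a circle. -/
theorem exists_iterate_tourStep (g : Fin N → Option (Fin N)) {v r : Fin N}
    (hr : g r = none) (hvr : Relation.ReflTransGen (fun u v => g u = some v) v r) :
    ∃ K, (tourStep g)^[K] (v, Fin.last N) = (r, Fin.last N) ∧ ∀ i < K,
      ¬ (((tourStep g)^[i] (v, Fin.last N)).2 = Fin.last N ∧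
        g ((tourStep g)^[i] (v, Fin.last N)).1 = none) := by
  have h := reflTransGen_passes_of_reflTransGen g hr hvr
  generalize (r, Fin.last N) = q at h
  induction h with
  | refl => exact ⟨0, rfl, by simp⟩
  | tail _ hbc ih =>
    obtain ⟨K, hK, hlt⟩ := ih
    refine ⟨K + 1, by rw [Function.iterate_succ_apply', hK, hbc.2], fun i hi => ?_⟩
    rcases Nat.lt_succ_iff_lt_or_eq.1 hi with hi | rfl
    · exact hlt i hi
    · rw [hK]; exact hbc.1

end ForestTour

/-! ### Programs whose steps are split between Alice and Bob -/

/-- A deterministic program with vertex set `V`: depending on the current vertex, the next one is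
determined by Alice from her input or by Bob from his. Some vertices carry a result, and the program
halts there. -/
structure SplitProgram (n : ℕ) (V : Type) where
  start : V
  result : V → Option Bool
  aliceNext : (Fin n → Bool) → V → Option V
  bobNext : (Fin n → Bool) → V → Option V
  disjoint : ∀ x y v, aliceNext x v = none ∨ bobNext y v = none
  aliceNext_start : ∀ x, aliceNext x start = none
  result_start : result start = none
  aliceNext_of_result : ∀ x v, result v ≠ none → aliceNext x v = none
  bobNext_of_result : ∀ y v, result v ≠ none → bobNext y v = none

namespace SplitProgram

open ForestTour

variable {n : ℕ}

/-- The joint transition function. -/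
def next {V : Type} (Q : SplitProgram n V) (x y : Fin n → Bool) (v : V) : Option V :=
  (Q.aliceNext x v).or (Q.bobNext y v)

/-- The program computes `f` if it always reaches a vertex that carries the value of `f`. -/
def Computes {V : Type} (Q : SplitProgram n V) (f : (Fin n → Bool) → (Fin n → Bool) → Bool) :
    Prop :=
  ∀ x y, ∃ r, Q.result r = some (f x y) ∧
    Relation.ReflTransGen (fun u v => Q.next x y u = some v) Q.start r

/-- Renaming the vertices of a program. -/
def congr {V W : Type} (e : V ≃ W) (Q : SplitProgram n V) : SplitProgram n W where
  start := e Q.start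
  result w := Q.result (e.symm w)
  aliceNext x w := (Q.aliceNext x (e.symm w)).map e
  bobNext y w := (Q.bobNext y (e.symm w)).map e
  disjoint x y w := by simpa using Q.disjoint x y (e.symm w)
  aliceNext_start x := by simp [Q.aliceNext_start]
  result_start := by simp [Q.result_start]
  aliceNext_of_result x w h := by simp [Q.aliceNext_of_result x _ h]
  bobNext_of_result y w h := by simp [Q.bobNext_of_result y _ h]

theorem Computes.congr {V W : Type} (e : V ≃ W) {Q : SplitProgram n V}
    {f : (Fin n → Bool) → (Fin n → Bool) → Bool} (hQ : Q.Computes f) :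
    (Q.congr e).Computes f := by
  intro x y
  obtain ⟨r, hr, hreach⟩ := hQ x y
  refine ⟨e r, by simpa [SplitProgram.congr] using hr, hreach.lift e fun u v h => ?_⟩
  simp only [next] at h
  simp only [Function.onFun, next, SplitProgram.congr, Equiv.symm_apply_apply, ← Option.map_or, h,
    Option.map_some]

variable {N : ℕ}

/-! ### The garden-hose game of a split program -/

/-- The pipes of the game: each slot `p` of each vertex has a pipe `(p, false)` leading the water to
the slot on Alice's side and a pipe `(p, true)` leading it on to the slot on Bob's side. -/
abbrev Pipe (N : ℕ) : Type := Corner N × Bool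

/-- Alice's connections, from the end where the water arrives to the one where it leaves. -/
def aliceEdge (Q : SplitProgram n (Fin N)) (x : Fin n → Bool) :
    Option (Pipe N) → Option (Pipe N) → Prop
  | none, some (q, true) => q = (Q.start, Fin.last N)
  | some (p, false), some (q, true) =>
    p ≠ (Q.start, Fin.last N) ∧ ¬ (p.2 = Fin.last N ∧ Q.result p.1 = some false) ∧
      q = swapAlong (Q.aliceNext x) p
  | _, _ => False

/-- Bob's connections, from the end where the water arrives to the one where it leaves. -/
def bobEdge (Q : SplitProgram n (Fin N)) (y : Fin n → Bool) : Pipe N → Pipe N → Prop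
  | (p, true), (q, false) =>
    ¬ (p.2 = Fin.last N ∧ Q.result p.1 = some true) ∧ q = rotate (swapAlong (Q.bobNext y) p)
  | _, _ => False

/-- The end that the start slot would be connected to is its own `true` pipe. Since that connection
is omitted, the tap can take its place for every `x`. -/
theorem swapAlong_start (Q : SplitProgram n (Fin N)) (x : Fin n → Bool) :
    swapAlong (Q.aliceNext x) (Q.start, Fin.last N) = (Q.start, Fin.last N) :=
  swapAlong_last_of_none (Q.aliceNext_start x)

/-- Ends labelled `false` (and the tap) are only sources and ends labelled `true` only targets. The
swap is injective, so no target is used twice. -/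
theorem aliceEdge_degree_le_one (Q : SplitProgram n (Fin N)) (x : Fin n → Bool)
    (u v w : Option (Pipe N)) (hv : (SimpleGraph.fromRel (Q.aliceEdge x)).Adj u v)
    (hw : (SimpleGraph.fromRel (Q.aliceEdge x)).Adj u w) : v = w := by
  have hinj := (swapAlong_involutive (Q.aliceNext x)).injective
  have hs := Q.swapAlong_start x
  rw [SimpleGraph.fromRel_adj] at hv hw
  replace hv := hv.2
  replace hw := hw.2
  rcases u with _ | ⟨u, _ | _⟩ <;> rcases v with _ | ⟨v, _ | _⟩ <;> rcases w with _ | ⟨w, _ | _⟩ <;>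
    simp only [aliceEdge, or_self, or_false, false_or] at hv hw ⊢ <;> grind [Function.Injective]

theorem bobEdge_degree_le_one (Q : SplitProgram n (Fin N)) (y : Fin n → Bool)
    (u v w : Pipe N) (hv : (SimpleGraph.fromRel (Q.bobEdge y)).Adj u v)
    (hw : (SimpleGraph.fromRel (Q.bobEdge y)).Adj u w) : v = w := by
  have hinj := rotate_injective.comp (swapAlong_involutive (Q.bobNext y)).injective
  rw [SimpleGraph.fromRel_adj] at hv hw
  replace hv := hv.2
  replace hw := hw.2
  rcases u with ⟨u, _ | _⟩ <;> rcases v with ⟨v, _ | _⟩ <;> rcases w with ⟨w, _ | _⟩ <;>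
    simp only [bobEdge, or_self, or_false, false_or] at hv hw ⊢
  · have := hinj (hv.2.symm.trans hw.2)
    rw [this]
  · rw [hv.2, hw.2]

/-- The garden-hose game in which the water makes the tour of the transition graph. -/
noncomputable def game (Q : SplitProgram n (Fin N)) : GardenHoseGame n where
  size := Fintype.card (Pipe N)
  alice x := (SimpleGraph.fromRel (Q.aliceEdge x)).comap (Option.map (Fintype.equivFin _).symm)
  bob y := (SimpleGraph.fromRel (Q.bobEdge y)).comap (Fintype.equivFin _).symm
  alice_degree_le_one x _ _ _ hv hw :=
    Option.map_injective (Equiv.injective _) (Q.aliceEdge_degree_le_one x _ _ _ hv hw)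
  bob_degree_le_one y _ _ _ hv hw :=
    Equiv.injective _ (Q.bobEdge_degree_le_one y _ _ _ hv hw)

theorem size_game (Q : SplitProgram n (Fin N)) : Q.game.size = N * (N + 1) * 2 := by
  simp [game]

/-- Alice's end of a pipe. -/
noncomputable def aliceEnd (Q : SplitProgram n (Fin N)) (p : Corner N) (b : Bool) : Q.game.Vertex :=
  Sum.inl (some (Fintype.equivFin (Pipe N) (p, b)))

/-- Bob's end of a pipe. -/
noncomputable def bobEnd (Q : SplitProgram n (Fin N)) (p : Corner N) (b : Bool) : Q.game.Vertex :=
  Sum.inr (Fintype.equivFin (Pipe N) (p, b))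

section Ends

variable (Q : SplitProgram n (Fin N)) (x y : Fin n → Bool)

theorem aliceEnd_inj {p q : Corner N} {b c : Bool} :
    Q.aliceEnd p b = Q.aliceEnd q c ↔ p = q ∧ b = c := by
  refine ⟨fun h => ?_, by rintro ⟨rfl, rfl⟩; rfl⟩
  exact Prod.mk.inj ((Fintype.equivFin (Pipe N)).injective (Option.some.inj (Sum.inl.inj h)))

theorem bobEnd_inj {p q : Corner N} {b c : Bool} :
    Q.bobEnd p b = Q.bobEnd q c ↔ p = q ∧ b = c := by
  refine ⟨fun h => ?_, by rintro ⟨rfl, rfl⟩; rfl⟩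
  exact Prod.mk.inj ((Fintype.equivFin (Pipe N)).injective (Sum.inr.inj h))

theorem aliceEnd_ne_bobEnd (p q : Corner N) (b c : Bool) : Q.aliceEnd p b ≠ Q.bobEnd q c :=
  Sum.inl_ne_inr

theorem bobEnd_ne_aliceEnd (p q : Corner N) (b c : Bool) : Q.bobEnd p b ≠ Q.aliceEnd q c :=
  Sum.inr_ne_inl

theorem aliceEnd_ne_tap (p : Corner N) (b : Bool) : Q.aliceEnd p b ≠ Q.game.tap := by
  intro h
  exact Option.some_ne_none _ (Sum.inl.inj h)

theorem bobEnd_ne_tap (p : Corner N) (b : Bool) : Q.bobEnd p b ≠ Q.game.tap :=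
  Sum.inr_ne_inl

theorem adj_pipe (p : Corner N) (b : Bool) :
    (Q.game.graph x y).Adj (Q.aliceEnd p b) (Q.bobEnd p b) :=
  rfl

theorem adj_tap : (Q.game.graph x y).Adj Q.game.tap (Q.aliceEnd (Q.start, Fin.last N) true) := by
  change (SimpleGraph.fromRel (Q.aliceEdge x)).Adj none (some ((Fintype.equivFin (Pipe N)).symm _))
  rw [Equiv.symm_apply_apply, SimpleGraph.fromRel_adj]
  exact ⟨by simp, Or.inl rfl⟩

variable {x} in
theorem adj_aliceEnd {p : Corner N} (hp : p ≠ (Q.start, Fin.last N))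
    (hp' : ¬ (p.2 = Fin.last N ∧ Q.result p.1 = some false)) :
    (Q.game.graph x y).Adj (Q.aliceEnd p false)
      (Q.aliceEnd (swapAlong (Q.aliceNext x) p) true) := by
  change (SimpleGraph.fromRel (Q.aliceEdge x)).Adj (some ((Fintype.equivFin (Pipe N)).symm _))
    (some ((Fintype.equivFin (Pipe N)).symm _))
  rw [Equiv.symm_apply_apply, Equiv.symm_apply_apply, SimpleGraph.fromRel_adj]
  exact ⟨by simp, Or.inl ⟨hp, hp', rfl⟩⟩

variable {y} in
theorem adj_bobEnd {p : Corner N} (hp : ¬ (p.2 = Fin.last N ∧ Q.result p.1 = some true)) :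
    (Q.game.graph x y).Adj (Q.bobEnd p true)
      (Q.bobEnd (rotate (swapAlong (Q.bobNext y) p)) false) := by
  change (SimpleGraph.fromRel (Q.bobEdge y)).Adj ((Fintype.equivFin (Pipe N)).symm _)
    ((Fintype.equivFin (Pipe N)).symm _)
  rw [Equiv.symm_apply_apply, Equiv.symm_apply_apply, SimpleGraph.fromRel_adj]
  exact ⟨by simp, Or.inl ⟨hp, rfl⟩⟩

variable {Q x y} in
/-- On Alice's side, no connection is attached to the exit at a vertex with result `false`. -/
theorem eq_bobEnd_of_adj_aliceEnd {r : Fin N} (hr : Q.result r = some false) {z : Q.game.Vertex}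
    (hz : (Q.game.graph x y).Adj (Q.aliceEnd (r, Fin.last N) false) z) :
    z = Q.bobEnd (r, Fin.last N) false := by
  rcases z with z | z
  · exfalso
    change (SimpleGraph.fromRel (Q.aliceEdge x)).Adj
      (some ((Fintype.equivFin (Pipe N)).symm _)) _ at hz
    rw [Equiv.symm_apply_apply, SimpleGraph.fromRel_adj] at hz
    generalize Option.map (Fintype.equivFin (Pipe N)).symm z = z' at hz
    rcases z' with _ | ⟨q, _ | _⟩ <;> simp [aliceEdge, hr] at hz
  · exact congrArg Sum.inr (Option.some.inj (Eq.symm hz))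

variable {Q x y} in
/-- On Bob's side, no connection is attached to the exit at a vertex with result `true`. -/
theorem eq_aliceEnd_of_adj_bobEnd {r : Fin N} (hr : Q.result r = some true) {z : Q.game.Vertex}
    (hz : (Q.game.graph x y).Adj (Q.bobEnd (r, Fin.last N) true) z) :
    z = Q.aliceEnd (r, Fin.last N) true := by
  rcases z with z | z
  · exact congrArg Sum.inl hz
  · exfalso
    change (SimpleGraph.fromRel (Q.bobEdge y)).Adj ((Fintype.equivFin (Pipe N)).symm _) _ at hz
    rw [Equiv.symm_apply_apply, SimpleGraph.fromRel_adj] at hz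
    generalize (Fintype.equivFin (Pipe N)).symm z = z' at hz
    rcases z' with ⟨q, _ | _⟩ <;> simp [bobEdge, hr] at hz

end Ends

/-! ### The path of the water -/

/-- There is a path from `u` to `v` whose vertices satisfy `T`. -/
def PathWithin {V : Type} (H : SimpleGraph V) (u v : V) (T : V → Prop) : Prop :=
  ∃ p : H.Walk u v, p.IsPath ∧ ∀ z ∈ p.support, T z

theorem PathWithin.concat {V : Type} {H : SimpleGraph V} {u v w : V} {T : V → Prop}
    (h : PathWithin H u v T) (hvw : H.Adj v w) (hw : ¬ T w) :
    PathWithin H u w (fun z => T z ∨ z = w) := by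
  obtain ⟨p, hp, hT⟩ := h
  refine ⟨p.concat hvw, hp.concat (fun h => hw (hT _ h)) hvw, fun z hz => ?_⟩
  rw [SimpleGraph.Walk.support_concat, List.mem_append, List.mem_singleton] at hz
  exact hz.imp (hT z) id

theorem PathWithin.mono {V : Type} {H : SimpleGraph V} {u v : V} {T T' : V → Prop}
    (h : PathWithin H u v T) (hT : ∀ z, T z → T' z) : PathWithin H u v T' :=
  h.imp fun _ hp => ⟨hp.1, fun z hz => hT z (hp.2 z hz)⟩

/-- A nontrivial path reaches `v` through its only neighbour, so that neighbour already lies on the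
path. -/
theorem PathWithin.exists_isMaximalPath {V : Type} {H : SimpleGraph V} {u v a : V} {T : V → Prop}
    (h : PathWithin H u v T) (huv : v ≠ u) (ha : ∀ z, H.Adj v z → z = a) :
    ∃ p : H.Walk u v, GardenHoseGame.IsMaximalPath p := by
  obtain ⟨p, hp, -⟩ := h
  have hnil : ¬ p.Nil := fun h => huv h.eq.symm
  refine ⟨p, hp, fun w hw => ?_⟩
  rw [ha w hw, ← ha _ (p.adj_penultimate hnil).symm]
  exact p.getVert_mem_support _

section Path

variable (Q : SplitProgram n (Fin N)) (x y : Fin n → Bool)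

/-- The slot reached after `i` steps of the tour. -/
noncomputable def slot (i : ℕ) : Corner N :=
  (tourStep (Q.next x y))^[i] (Q.start, Fin.last N)

theorem slot_succ (i : ℕ) : Q.slot x y (i + 1) =
    rotate (swapAlong (Q.bobNext y) (swapAlong (Q.aliceNext x) (Q.slot x y i))) := by
  rw [slot, Function.iterate_succ_apply', swapAlong_swapAlong (Q.disjoint x y)]
  rfl

/-- The ends of pipes passed by the water in the first `i` steps of the tour. -/
def Passed (i : ℕ) (z : Q.game.Vertex) : Prop :=
  z = Q.game.tap ∨
  (∃ j, 0 < j ∧ j ≤ i ∧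
    (z = Q.aliceEnd (Q.slot x y j) false ∨ z = Q.bobEnd (Q.slot x y j) false)) ∨
  ∃ j < i, z = Q.aliceEnd (swapAlong (Q.aliceNext x) (Q.slot x y j)) true ∨
    z = Q.bobEnd (swapAlong (Q.aliceNext x) (Q.slot x y j)) true

/-- The end of a pipe on Alice's side (or the tap) at which the water arrives after `i` steps. -/
noncomputable def arrival (i : ℕ) : Q.game.Vertex :=
  if i = 0 then Q.game.tap else Q.aliceEnd (Q.slot x y i) false

variable {Q x y}

theorem next_of_result {v : Fin N} (h : Q.result v ≠ none) : Q.next x y v = none := by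
  simp [next, Q.aliceNext_of_result x v h, Q.bobNext_of_result y v h]

theorem not_exit {p : Corner N} (hp : ¬ (p.2 = Fin.last N ∧ Q.next x y p.1 = none)) (b : Bool) :
    ¬ (p.2 = Fin.last N ∧ Q.result p.1 = some b) :=
  fun h => hp ⟨h.1, next_of_result (by simp [h.2])⟩

/-- If a slot is not an exit, neither is the one to which Alice leads the water. -/
theorem not_exit_swapAlong {p : Corner N}
    (hp : ¬ (p.2 = Fin.last N ∧ Q.next x y p.1 = none)) (b : Bool) :
    ¬ ((swapAlong (Q.aliceNext x) p).2 = Fin.last N ∧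
      Q.result (swapAlong (Q.aliceNext x) p).1 = some b) := by
  rintro ⟨h1, h2⟩
  generalize hq : swapAlong (Q.aliceNext x) p = q at h1 h2
  obtain ⟨v, s⟩ := q
  obtain rfl : s = Fin.last N := h1
  have hne : Q.result v ≠ none := by simp [show Q.result v = some b from h2]
  -- Alice is idle at vertices with a result, so her swap fixes this slot. Being an involution, it
  -- can only have come from the slot itself.
  have hfix := swapAlong_last_of_none (Q.aliceNext_of_result x v hne)
  rw [← hq, swapAlong_involutive, hq] at hfix
  exact hp (hfix ▸ ⟨rfl, next_of_result hne⟩)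

/-- The water passes from Alice's arrival end through the next pipe to Bob's side. -/
theorem pathWithin_bobEnd {i : ℕ} (hne : ∀ j < i, Q.slot x y j ≠ Q.slot x y i)
    (hexit : ¬ ((Q.slot x y i).2 = Fin.last N ∧ Q.result (Q.slot x y i).1 = some false))
    (h : PathWithin (Q.game.graph x y) Q.game.tap (Q.arrival x y i) (Q.Passed x y i)) :
    PathWithin (Q.game.graph x y) Q.game.tap
      (Q.bobEnd (swapAlong (Q.aliceNext x) (Q.slot x y i)) true)
      (fun z => (Q.Passed x y i z ∨ z = Q.aliceEnd (swapAlong (Q.aliceNext x) (Q.slot x y i)) true) ∨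
        z = Q.bobEnd (swapAlong (Q.aliceNext x) (Q.slot x y i)) true) := by
  have hinj := (swapAlong_involutive (Q.aliceNext x)).injective
  have hadj : (Q.game.graph x y).Adj (Q.arrival x y i)
      (Q.aliceEnd (swapAlong (Q.aliceNext x) (Q.slot x y i)) true) := by
    -- At time `0` the tap supplies the connection. Later the slot differs from the start slot,
    -- whose connection is the omitted one.
    rcases Nat.eq_zero_or_pos i with rfl | hi
    · simpa [arrival, slot, Q.swapAlong_start] using Q.adj_tap x y
    · rw [arrival, if_neg hi.ne']
      exact Q.adj_aliceEnd y (fun h => hne 0 hi h.symm) hexit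
  have hnot : ∀ j < i, swapAlong (Q.aliceNext x) (Q.slot x y i) ≠
      swapAlong (Q.aliceNext x) (Q.slot x y j) := fun j hj h => hne j hj (hinj h.symm)
  refine (h.concat hadj ?_).concat (Q.adj_pipe x y _ true) ?_
  · rintro (h | ⟨j, -, -, h | h⟩ | ⟨j, hj, h | h⟩)
    · exact Q.aliceEnd_ne_tap _ _ h
    · simpa using (Q.aliceEnd_inj.1 h).2
    · exact Q.aliceEnd_ne_bobEnd _ _ _ _ h
    · exact hnot j hj (Q.aliceEnd_inj.1 h).1
    · exact Q.aliceEnd_ne_bobEnd _ _ _ _ h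
  · rintro ((h | ⟨j, -, -, h | h⟩ | ⟨j, hj, h | h⟩) | h)
    · exact Q.bobEnd_ne_tap _ _ h
    · exact Q.bobEnd_ne_aliceEnd _ _ _ _ h
    · simpa using (Q.bobEnd_inj.1 h).2
    · exact Q.bobEnd_ne_aliceEnd _ _ _ _ h
    · exact hnot j hj (Q.bobEnd_inj.1 h).1
    · exact Q.bobEnd_ne_aliceEnd _ _ _ _ h

/-- As long as the tour neither closes nor meets an exit, the water follows it. -/
theorem pathWithin_arrival {K : ℕ} (hinj : ∀ i j, i < j → j ≤ K → Q.slot x y i ≠ Q.slot x y j)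
    (hK : ∀ i < K, ¬ ((Q.slot x y i).2 = Fin.last N ∧ Q.next x y (Q.slot x y i).1 = none)) :
    ∀ i ≤ K, PathWithin (Q.game.graph x y) Q.game.tap (Q.arrival x y i) (Q.Passed x y i) := by
  intro i
  induction i with
  | zero =>
    intro _
    rw [arrival, if_pos rfl]
    exact ⟨SimpleGraph.Walk.nil, by simp, fun z hz => Or.inl (by simpa using hz)⟩
  | succ i ih =>
    intro hi
    have h := pathWithin_bobEnd (fun j hj => hinj j i hj (by omega)) (not_exit (hK i hi) false)
      (ih (by omega))
    have hadj := Q.adj_bobEnd x (y := y) (not_exit_swapAlong (hK i hi) true)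
    rw [← slot_succ] at hadj
    have h' : PathWithin _ _ _ _ := (h.concat hadj ?_).concat (Q.adj_pipe x y _ false).symm ?_
    · rw [arrival, if_neg i.succ_ne_zero]
      refine h'.mono ?_
      rintro z (((((h | ⟨j, hj, hji, h⟩ | ⟨j, hj, h⟩) | h) | h) | h) | h)
      · exact Or.inl h
      · exact Or.inr (Or.inl ⟨j, hj, by omega, h⟩)
      · exact Or.inr (Or.inr ⟨j, by omega, h⟩)
      · exact Or.inr (Or.inr ⟨i, by omega, Or.inl h⟩)
      · exact Or.inr (Or.inr ⟨i, by omega, Or.inr h⟩)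
      · exact Or.inr (Or.inl ⟨i + 1, by omega, le_rfl, Or.inr h⟩)
      · exact Or.inr (Or.inl ⟨i + 1, by omega, le_rfl, Or.inl h⟩)
    · rintro (((h | ⟨j, -, hj, h | h⟩ | ⟨j, hj, h | h⟩) | h) | h)
      · exact Q.bobEnd_ne_tap _ _ h
      · exact Q.bobEnd_ne_aliceEnd _ _ _ _ h
      · exact hinj j (i + 1) (by omega) hi (Q.bobEnd_inj.1 h).1.symm
      · exact Q.bobEnd_ne_aliceEnd _ _ _ _ h
      · simpa using (Q.bobEnd_inj.1 h).2
      · exact Q.bobEnd_ne_aliceEnd _ _ _ _ h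
      · simpa using (Q.bobEnd_inj.1 h).2
    · rintro ((((h | ⟨j, -, hj, h | h⟩ | ⟨j, hj, h | h⟩) | h) | h) | h)
      · exact Q.aliceEnd_ne_tap _ _ h
      · exact hinj j (i + 1) (by omega) hi (Q.aliceEnd_inj.1 h).1.symm
      · exact Q.aliceEnd_ne_bobEnd _ _ _ _ h
      · simpa using (Q.aliceEnd_inj.1 h).2
      · exact Q.aliceEnd_ne_bobEnd _ _ _ _ h
      · simpa using (Q.aliceEnd_inj.1 h).2
      · exact Q.aliceEnd_ne_bobEnd _ _ _ _ h
      · exact Q.aliceEnd_ne_bobEnd _ _ _ _ h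

end Path

/-- At the last slot of the result vertex the water stops on Alice's side if the result is `false`.
Otherwise it crosses one more pipe and stops on Bob's side. -/
theorem Computes.game {Q : SplitProgram n (Fin N)} {f : (Fin n → Bool) → (Fin n → Bool) → Bool}
    (hQ : Q.Computes f) : Q.game.Computes f := by
  intro x y
  obtain ⟨r, hr, hreach⟩ := hQ x y
  have hrnext : Q.next x y r = none := next_of_result (by simp [hr])
  obtain ⟨K, hKr, hK⟩ := exists_iterate_tourStep (Q.next x y) hrnext hreach
  change Q.slot x y K = _ at hKr
  -- If times `i < j` gave the same slot, then `K - j` steps after time `i` the tour would be at the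
  -- exit, before time `K`.
  have hinj : ∀ i j, i < j → j ≤ K → Q.slot x y i ≠ Q.slot x y j := by
    intro i j hij hj h
    have h' : Q.slot x y (K - j + i) = Q.slot x y K := by
      have := congrArg (tourStep (Q.next x y))^[K - j] h
      simp only [slot, ← Function.iterate_add_apply] at this ⊢
      rwa [Nat.sub_add_cancel hj] at this
    refine hK (K - j + i) (by omega) ?_
    change (Q.slot x y (K - j + i)).2 = _ ∧ Q.next x y (Q.slot x y (K - j + i)).1 = _
    rw [h', hKr]
    exact ⟨rfl, hrnext⟩
  -- The start carries no result, so the water has left the tap.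
  have hK0 : K ≠ 0 := by
    rintro rfl
    have : Q.start = r := congrArg Prod.fst hKr
    simp [← this, Q.result_start] at hr
  have hpath := pathWithin_arrival hinj hK K le_rfl
  cases hf : f x y with
  | false =>
    rw [hf] at hr
    rw [arrival, if_neg hK0, hKr] at hpath
    exact ⟨_, hpath.exists_isMaximalPath (Q.aliceEnd_ne_tap _ _)
      (fun z hz => eq_bobEnd_of_adj_aliceEnd hr hz), fun _ => rfl, by simp⟩
  | true =>
    rw [hf] at hr
    have h := pathWithin_bobEnd (fun j hj => hinj j K hj le_rfl) (by simp [hKr, hr]) hpath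
    rw [hKr, swapAlong_last_of_none (Q.aliceNext_of_result x r (by simp [hr]))] at h
    exact ⟨_, h.exists_isMaximalPath (Q.bobEnd_ne_tap _ _)
      (fun z hz => eq_aliceEnd_of_adj_bobEnd hr hz), by simp, fun _ => rfl⟩

/-- A function computed by a split program with `N` vertices has a garden-hose game with
`2 N (N + 1)` pipes. -/
theorem Computes.gardenHoseComplexity_le {V : Type} [Finite V] {Q : SplitProgram n V}
    {f : (Fin n → Bool) → (Fin n → Bool) → Bool} (hQ : Q.Computes f) :
    gardenHoseComplexity f ≤ ((Nat.card V * (Nat.card V + 1) * 2 : ℕ) : ℕ∞) := by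
  rw [← size_game (Q.congr (Finite.equivFin V))]
  exact iInf₂_le (f := fun (G : GardenHoseGame n) (_ : G.Computes f) => (G.size : ℕ∞)) _
    (hQ.congr (Finite.equivFin V)).game

end SplitProgram

/-! ### Configurations of machines with bounded space -/

namespace OfflineTM

variable {M : OfflineTM}

/-- A step depends on the input word only through its length and the scanned symbol. -/
theorem step_congr {w w' : List Bool} {c : M.Cfg} (hlen : w.length = w'.length)
    (h : inputSymbol w c.inputHead = inputSymbol w' c.inputHead) : M.step w c = M.step w' c := by
  simp only [step, hlen, h]

/-- Cell `p + 1` holds the letter of index `p`, so the cells up to `u.length`, left marker included,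
depend on `u` alone. -/
theorem inputSymbol_append_of_le (u v v' : List Bool) {p : ℕ} (hp : p ≤ u.length) :
    inputSymbol (u ++ v) p = inputSymbol (u ++ v') p := by
  cases p with
  | zero => rfl
  | succ p => simp only [inputSymbol, List.getElem?_append_left (Nat.lt_of_succ_le hp)]

theorem inputSymbol_append_of_lt {u u' : List Bool} (v : List Bool) (hu : u.length = u'.length)
    {p : ℕ} (hp : u.length < p) : inputSymbol (u ++ v) p = inputSymbol (u' ++ v) p := by
  cases p with
  | zero => omega
  | succ p =>
    simp only [inputSymbol, List.getElem?_append_right (Nat.le_of_lt_succ hp),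
      List.getElem?_append_right (hu ▸ Nat.le_of_lt_succ hp), hu]

theorem run_succ (w : List Bool) (t : ℕ) : M.run w (t + 1) = M.step w (M.run w t) :=
  Function.iterate_succ_apply' _ _ _

theorem inputHead_run_le (w : List Bool) (t : ℕ) : (M.run w t).inputHead ≤ w.length + 1 := by
  induction t with
  | zero => simp [run, init]
  | succ t ih =>
    rw [run_succ]
    unfold step
    split_ifs with h
    · exact ih
    · dsimp only
      generalize (M.trans _ _ _).2.1 = m
      cases m <;> simp only [moveInput] <;> omega

theorem natAbs_workHead_step_sub_le (w : List Bool) (c : M.Cfg) (i : Fin M.tapes) :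
    ((M.step w c).workHead i - c.workHead i).natAbs ≤ 1 := by
  unfold step
  split_ifs with h
  · simp
  · dsimp only
    generalize ((M.trans _ _ _).2.2 i).2 = m
    cases m <;> simp [moveWork]

/-- A work head visits all locations between its starting position and its current position. -/
theorem mem_visited_of_between (w : List Bool) (i : Fin M.tapes) (t : ℕ) (z : ℤ)
    (hz : (0 ≤ z ∧ z ≤ (M.run w t).workHead i) ∨ ((M.run w t).workHead i ≤ z ∧ z ≤ 0)) :
    (i, z) ∈ M.visited w := by
  induction t with
  | zero =>
    refine ⟨0, ?_⟩
    simp only [run, init, Function.iterate_zero, id_eq] at hz ⊢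
    omega
  | succ t ih =>
    by_cases h : (M.run w (t + 1)).workHead i = z
    · exact ⟨t + 1, h⟩
    · apply ih
      have := natAbs_workHead_step_sub_le w (M.run w t) i
      rw [← run_succ] at this
      omega

/-- Heads start at `0` and move by at most one cell, so reaching `z` means visiting at least
`z.natAbs + 1` locations. A bound on the number of visited locations thus confines the heads to a
window around `0`. -/
theorem natAbs_lt_ncard_visited {w : List Bool} (hfin : (M.visited w).Finite) {i : Fin M.tapes}
    {z : ℤ} (hz : (i, z) ∈ M.visited w) : z.natAbs < (M.visited w).ncard := by
  obtain ⟨t, ht⟩ := hz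
  simp only at ht
  have hsub : (fun a : ℤ => (i, a)) '' (Finset.Icc (min 0 z) (max 0 z) : Finset ℤ) ⊆
      M.visited w := by
    rintro _ ⟨a, ha, rfl⟩
    rw [Finset.mem_coe, Finset.mem_Icc] at ha
    exact mem_visited_of_between w i t a (by rw [ht]; omega)
  have hcard := Set.ncard_le_ncard hsub hfin
  rw [Set.ncard_image_of_injective _ (fun a b h => (Prod.mk.inj h).2), Set.ncard_coe_finset,
    Int.card_Icc] at hcard
  omega

theorem work_run_eq_blank {w : List Bool} {i : Fin M.tapes} {z : ℤ} (hz : (i, z) ∉ M.visited w)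
    (t : ℕ) : (M.run w t).work i z = M.blank := by
  induction t with
  | zero => rfl
  | succ t ih =>
    rw [run_succ]
    unfold step
    split_ifs with h
    · exact ih
    · dsimp only
      rw [Function.update_of_ne, ih]
      rintro rfl
      exact hz ⟨t, rfl⟩

variable (M) in
/-- The configurations on input words of length `N` that use only the locations `-K, …, K`. -/
def boundedCfg (N K : ℕ) : Set M.Cfg :=
  {c | c.inputHead ≤ N + 1 ∧ (∀ i, (c.workHead i).natAbs ≤ K) ∧
    ∀ i z, K < z.natAbs → c.work i z = M.blank}

theorem init_mem_boundedCfg (N K : ℕ) : M.init ∈ M.boundedCfg N K :=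
  ⟨by simp [init], by simp [init], by simp [init]⟩

theorem run_mem_boundedCfg {w : List Bool} {K : ℕ} (hfin : (M.visited w).Finite)
    (hK : (M.visited w).ncard ≤ K) (t : ℕ) : M.run w t ∈ M.boundedCfg w.length K := by
  refine ⟨inputHead_run_le w t, fun i => ?_, fun i z hz => work_run_eq_blank (fun h => ?_) t⟩
  · exact ((natAbs_lt_ncard_visited hfin ⟨t, rfl⟩).trans_le hK).le
  · have := natAbs_lt_ncard_visited hfin h
    omega

variable (M) in
/-- The data that determine a bounded configuration. -/
def boundedCfgCode (N K : ℕ) (c : M.boundedCfg N K) :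
    M.State × Fin (N + 2) × (Fin M.tapes → Finset.Icc (-(K : ℤ)) K) ×
      (Fin M.tapes → Finset.Icc (-(K : ℤ)) K → M.Symbol) :=
  (c.1.state, ⟨c.1.inputHead, Nat.lt_succ_of_le c.2.1⟩,
    fun i => ⟨c.1.workHead i, by have := c.2.2.1 i; rw [Finset.mem_Icc]; omega⟩,
    fun i z => c.1.work i z)

theorem boundedCfgCode_injective (N K : ℕ) : Function.Injective (M.boundedCfgCode N K) := by
  rintro ⟨⟨s, p, h, k⟩, hc⟩ ⟨⟨s', p', h', k'⟩, hc'⟩ heq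
  simp only [boundedCfgCode, Prod.mk.injEq, Fin.mk.injEq] at heq
  obtain ⟨rfl, rfl, hh, hk⟩ := heq
  obtain rfl : h = h' := funext fun i => congrArg Subtype.val (congrFun hh i)
  obtain rfl : k = k' := by
    funext i z
    by_cases hz : z ∈ Finset.Icc (-(K : ℤ)) K
    · exact congrFun (congrFun hk i) ⟨z, hz⟩
    · have hz' : K < z.natAbs := by rw [Finset.mem_Icc] at hz; omega
      exact (hc.2.2 i z hz').trans (hc'.2.2 i z hz').symm
  rfl

instance finite_boundedCfg (N K : ℕ) : Finite (M.boundedCfg N K) :=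
  have := M.stateFintype
  have := M.symbolFintype
  Finite.of_injective _ (boundedCfgCode_injective N K)

theorem card_boundedCfg_le (N K : ℕ) : Nat.card (M.boundedCfg N K) ≤
    Nat.card M.State * ((N + 2) * ((2 * K + 1) ^ M.tapes *
      (Nat.card M.Symbol ^ (2 * K + 1)) ^ M.tapes)) := by
  have := M.stateFintype
  have := M.symbolFintype
  have hIcc : Nat.card (Finset.Icc (-(K : ℤ)) K) = 2 * K + 1 := by
    rw [Nat.card_eq_fintype_card, Fintype.card_coe, Int.card_Icc]
    omega
  refine (Nat.card_le_card_of_injective _ (boundedCfgCode_injective N K)).trans_eq ?_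
  simp only [Nat.card_prod, Nat.card_fun, hIcc, Nat.card_fin]

variable (M) in
-- The machine as a split program
/-- A configuration is halted if its state is accepting or rejecting. -/
def Halted (c : M.Cfg) : Prop := c.state = M.accept ∨ c.state = M.reject

open Classical in
/-- A step of a configuration that is not halted, provided that it stays within bounds. -/
noncomputable def boundedStep {N K : ℕ} (w : List Bool) (c : M.boundedCfg N K) :
    Option (Option (M.boundedCfg N K)) :=
  -- The outer `some` says that there is a successor. The inner one makes it a vertex of the split
  -- program, whose extra vertex is `none`.
  if h : ¬ M.Halted c.1 ∧ M.step w c.1 ∈ M.boundedCfg N K then some (some ⟨M.step w c.1, h.2⟩)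
  else none

theorem boundedStep_of_halted {N K : ℕ} {w : List Bool} {c : M.boundedCfg N K}
    (h : M.Halted c.1) : boundedStep w c = none := by
  simp [boundedStep, h]

theorem boundedStep_congr {N K : ℕ} {w w' : List Bool} {c : M.boundedCfg N K}
    (h : M.step w c.1 = M.step w' c.1) : boundedStep w c = boundedStep w' c := by
  unfold boundedStep
  congr!

open Classical in
/-- The output of a halted configuration. -/
noncomputable def output (c : M.Cfg) : Option Bool :=
  if c.state = M.accept then some true else if c.state = M.reject then some false else none

theorem halted_of_output_ne_none {c : M.Cfg} (h : output c ≠ none) : M.Halted c := by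
  by_contra hc
  simp only [Halted, not_or] at hc
  simp [output, hc.1, hc.2] at h

/-- The machine as a split program. Alice makes the steps in which the scanned symbol is the left
end marker or in her part of the input word, and Bob makes the others. The vertex `none` is a start
from which Bob leads to the starting configuration. -/
noncomputable def splitProgram (M : OfflineTM) (n K : ℕ) :
    SplitProgram n (Option (M.boundedCfg (n + n) K)) where
  -- The initial configuration cannot serve as start: its head is on the left marker, where Alice
  -- moves, and it might already be halted.
  start := none
  result v := v.bind fun c => output c.1
  aliceNext x v := v.bind fun c =>
    -- The other player's half is unknown and is filled with `false`; the scanned cell does not lie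
    -- in it.
    if c.1.inputHead ≤ n then boundedStep (List.ofFn x ++ List.ofFn fun _ : Fin n => false) c
    else none
  bobNext y v := v.elim (some (some ⟨M.init, init_mem_boundedCfg _ _⟩)) fun c =>
    if c.1.inputHead ≤ n then none
    else boundedStep ((List.ofFn fun _ : Fin n => false) ++ List.ofFn y) c
  disjoint x y v := by
    rcases v with _ | c
    · simp
    · by_cases h : c.1.inputHead ≤ n <;> simp [h]
  aliceNext_start x := rfl
  result_start := rfl
  aliceNext_of_result x v h := by
    rcases v with _ | c
    · rfl
    · simp [boundedStep_of_halted (halted_of_output_ne_none (c := c.1) h)]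
  bobNext_of_result y v h := by
    rcases v with _ | c
    · exact absurd rfl h
    · simp [boundedStep_of_halted (halted_of_output_ne_none (c := c.1) h)]

theorem splitProgram_next {n K : ℕ} (x y : Fin n → Bool) (c : M.boundedCfg (n + n) K) :
    (M.splitProgram n K).next x y (some c) = boundedStep (List.ofFn x ++ List.ofFn y) c := by
  by_cases h : c.1.inputHead ≤ n
  · simp only [SplitProgram.next, splitProgram, Option.bind_some, Option.elim_some, h, if_true,
      Option.or_none]
    exact boundedStep_congr
      (step_congr (by simp) (inputSymbol_append_of_le _ _ _ (by simpa using h)))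
  · simp only [SplitProgram.next, splitProgram, Option.bind_some, Option.elim_some, h, if_false,
      Option.none_or]
    exact boundedStep_congr
      (step_congr (by simp) (inputSymbol_append_of_lt _ (by simp) (by simpa using h)))

theorem splitProgram_computes {n K : ℕ} {f : (Fin n → Bool) → (Fin n → Bool) → Bool}
    (hout : ∀ x y, M.Outputs (List.ofFn x ++ List.ofFn y) (f x y))
    (hfin : ∀ x y : Fin n → Bool, (M.visited (List.ofFn x ++ List.ofFn y)).Finite)
    (hK : ∀ x y : Fin n → Bool, (M.visited (List.ofFn x ++ List.ofFn y)).ncard ≤ K) :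
    (M.splitProgram n K).Computes f := by
  intro x y
  have hmem : ∀ t, M.run (List.ofFn x ++ List.ofFn y) t ∈ M.boundedCfg (n + n) K := by
    intro t
    simpa using run_mem_boundedCfg (hfin x y) (hK x y) t
  have hreach : ∀ t, Relation.ReflTransGen
      (fun u v => (M.splitProgram n K).next x y u = some v) none (some ⟨_, hmem t⟩) := by
    intro t
    induction t with
    | zero => exact .single rfl
    | succ t ih =>
      by_cases h : M.Halted (M.run (List.ofFn x ++ List.ofFn y) t)
      · have : M.run (List.ofFn x ++ List.ofFn y) (t + 1) =
            M.run (List.ofFn x ++ List.ofFn y) t := by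
          rw [run_succ]
          exact if_pos h
        simpa only [this] using ih
      · refine ih.tail ?_
        have hm := hmem (t + 1)
        rw [run_succ] at hm
        simp only [splitProgram_next, boundedStep, h, hm, not_false_eq_true, and_self, dite_true,
          run_succ]
  obtain ⟨t, ht⟩ := hout x y
  refine ⟨_, ?_, hreach t⟩
  change output (M.run (List.ofFn x ++ List.ofFn y) t) = _
  cases hf : f x y with
  | false => simp [output, ht, hf, M.accept_ne_reject.symm]
  | true => simp [output, ht, hf]

end OfflineTM

/-! ### The polynomial bound -/

/-- A constant function has garden-hose complexity at most `12`. -/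
theorem gardenHoseComplexity_le_of_const {n : ℕ} {f : (Fin n → Bool) → (Fin n → Bool) → Bool}
    (b : Bool) (hf : ∀ x y, f x y = b) : gardenHoseComplexity f ≤ 12 := by
  let Q : SplitProgram n Bool :=
    { start := false
      result := fun v => if v then some b else none
      aliceNext := fun _ _ => none
      bobNext := fun _ v => if v then none else some true
      disjoint := fun _ _ _ => Or.inl rfl
      aliceNext_start := fun _ => rfl
      result_start := rfl
      aliceNext_of_result := fun _ _ _ => rfl
      bobNext_of_result := fun _ v h => by cases v <;> simp_all }
  have hQ : Q.Computes f := fun x y => ⟨true, by simp [Q, hf], .single rfl⟩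
  simpa using hQ.gardenHoseComplexity_le

/-- This gives a natural number depending only on `n` as common window size. The logarithm is
nonnegative for `n ≥ 1`, so a negative `c` does no harm. -/
theorem ncard_le_of_le_mul_logb {m n : ℕ} {c : ℝ} (hn : 1 ≤ n)
    (h : (m : ℝ) ≤ c * Real.logb 2 (2 * (n : ℝ))) : m ≤ ⌈c⌉₊ * (Nat.log 2 (2 * n) + 1) := by
  have hn' : (1 : ℝ) ≤ 2 * (n : ℝ) := by
    have : (1 : ℝ) ≤ n := by exact_mod_cast hn
    linarith
  have hlog : Real.logb 2 (2 * (n : ℝ)) ≤ (Nat.log 2 (2 * n) + 1 : ℕ) := by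
    rw [Real.logb_le_iff_le_rpow (by norm_num) (by linarith), Real.rpow_natCast]
    exact_mod_cast (Nat.lt_pow_succ_log_self (b := 2) (by norm_num) (2 * n)).le
  have h0 : 0 ≤ Real.logb 2 (2 * (n : ℝ)) := Real.logb_nonneg (by norm_num) hn'
  have : (m : ℝ) ≤ (⌈c⌉₊ * (Nat.log 2 (2 * n) + 1) : ℕ) := by
    push_cast at hlog ⊢
    exact h.trans (mul_le_mul (Nat.le_ceil c) hlog h0 (Nat.cast_nonneg _))
  exact_mod_cast this

/-- The number of configurations with logarithmic space bound is polynomially bounded. -/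
theorem OfflineTM.exists_polynomial_card_boundedCfg_le (M : OfflineTM) (d : ℕ) :
    ∃ p : Polynomial ℕ, ∀ n : ℕ, 1 ≤ n →
      Nat.card (M.boundedCfg (n + n) (d * (Nat.log 2 (2 * n) + 1))) ≤ p.eval n := by
  set a := Nat.card M.Symbol
  -- The factors majorise those of `card_boundedCfg_le` in turn: states, input positions, work head
  -- positions, tape contents.
  refine ⟨.C (Nat.card M.State) * ((2 * .X + 2) * ((8 * .C d * .X + 1) ^ M.tapes *
    (.C (2 ^ a) * (4 * .X) ^ (2 * a * d)) ^ M.tapes)), fun n hn => ?_⟩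
  refine (card_boundedCfg_le _ _).trans ?_
  have hpow : 2 ^ (Nat.log 2 (2 * n) + 1) ≤ 4 * n := by
    have := Nat.pow_log_le_self 2 (x := 2 * n) (by omega)
    rw [pow_succ]
    omega
  have hlog : Nat.log 2 (2 * n) + 1 ≤ 4 * n := Nat.lt_two_pow_self.le.trans hpow
  generalize Nat.log 2 (2 * n) + 1 = L at hpow hlog
  have h1 : 2 * (d * L) + 1 ≤ 8 * d * n + 1 := by
    have := Nat.mul_le_mul_left (2 * d) hlog
    linarith
  -- Replacing the alphabet size `a` by `2 ^ a` lets the exponent be regrouped around `2 ^ L ≤ 4 *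
  -- n`.
  have h2 : a ^ (2 * (d * L) + 1) ≤ 2 ^ a * (4 * n) ^ (2 * a * d) :=
    calc a ^ (2 * (d * L) + 1) ≤ (2 ^ a) ^ (2 * (d * L) + 1) :=
          Nat.pow_le_pow_left Nat.lt_two_pow_self.le _
      _ = 2 ^ a * (2 ^ L) ^ (2 * a * d) := by ring
      _ ≤ 2 ^ a * (4 * n) ^ (2 * a * d) :=
          Nat.mul_le_mul_left _ (Nat.pow_le_pow_left hpow _)
  simp only [Polynomial.eval_mul, Polynomial.eval_add, Polynomial.eval_pow, Polynomial.eval_C,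
    Polynomial.eval_X, Polynomial.eval_ofNat, Polynomial.eval_one]
  rw [← two_mul]
  gcongr

/-- The garden-hose complexity of a log-space computable function is polynomial in `n`. -/
theorem mainTheorem1 (f : ∀ n : ℕ, (Fin n → Bool) → (Fin n → Bool) → Bool)
    (hf : LogSpaceComputable f) :
    ∃ p : Polynomial ℕ, ∀ n : ℕ, gardenHoseComplexity (f n) ≤ ((p.eval n : ℕ) : ℕ∞) := by
  obtain ⟨M, c, hM⟩ := hf
  obtain ⟨p, hp⟩ := M.exists_polynomial_card_boundedCfg_le ⌈c⌉₊
  -- The extra start vertex makes `N ≤ p + 1` in `2 N (N + 1)`. The summand `12` covers `n = 0`,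
  -- where the machine is unconstrained but the function is constant.
  refine ⟨(p + 1) * (p + 2) * 2 + 12, fun n => ?_⟩
  simp only [Polynomial.eval_mul, Polynomial.eval_add, Polynomial.eval_ofNat, Polynomial.eval_one]
  rcases Nat.eq_zero_or_pos n with rfl | hn
  · refine (gardenHoseComplexity_le_of_const (f 0 Fin.elim0 Fin.elim0) fun x y => ?_).trans ?_
    · rw [Subsingleton.elim x Fin.elim0, Subsingleton.elim y Fin.elim0]
    · exact_mod_cast Nat.le_add_left _ _
  · have hQ := OfflineTM.splitProgram_computes (M := M) (n := n)
      (fun x y => (hM n hn x y).1) (fun x y => (hM n hn x y).2.1)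
      (fun x y => ncard_le_of_le_mul_logb hn (hM n hn x y).2.2)
    refine hQ.gardenHoseComplexity_le.trans ?_
    rw [Finite.card_option]
    norm_cast
    refine Nat.le_trans ?_ (Nat.le_add_right _ 12)
    have := hp n hn
    exact Nat.mul_le_mul_right _ (Nat.mul_le_mul (by omega) (by omega))
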